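/- Let $X$ be a Fréchet space over $\mathbb{K}\in\{\mathbb{R},\mathbb{C}\}$, i.e. a complete metrizable locally convex space. Then $X$ is nuclear if and only if every unconditionally convergent series in $X$ is absolutely convergent. Here: * $X$ is nuclear if for each continuous seminorm $p$ on $X$ there is a continuous seminorm $q\ge p$ on $X$ such that the identity map $(X,q)\to(X,p)$ is nuclear, that is, there are $(\lambda_n)\in\ell_1$, linear functionals $f_n$ on $X$ with $\sup_n\sup_{q(x)\le 1}|f_n(x)|<\infty$, and $y_n\in X$ with $\sup_n p(y_n)<\infty$ such that for every $x\in X$ one has $\lim_{N\to\infty}p\bigl(x-\sum_{n=1}^{N}\lambda_n f_n(x)\,y_n\bigr)=0$. * A series $\sum_n x_n$ in $X$ is unconditionally convergent if $\sum_n x_{\pi(n)}$ converges in $X$ for every permutation $\pi$ of $\mathbb{N}$. * A series $\sum_n x_n$ in $X$ is absolutely convergent if $\sum_n p(x_n)<\infty$ for every continuous seminorm $p$ on $X$. -/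

import Mathlib

open Filter Topology

/-- `T : (E, q) → (F, p)` is a nuclear map of seminormed spaces: there are a summable scalar
sequence `a`, a norm-bounded sequence `f` in the dual of `(E, q)` and a bounded sequence `y` in
`(F, p)` such that, for every `x`, the series `∑ a n • f n x • y n` converges to `T x` in
`(F, p)`. -/
def IsNuclearMap {𝕜 E F : Type*} [RCLike 𝕜] [AddCommGroup E] [Module 𝕜 E]
    [AddCommGroup F] [Module 𝕜 F] (q : Seminorm 𝕜 E) (p : Seminorm 𝕜 F)
    (T : E →ₗ[𝕜] F) : Prop :=
  ∃ (a : ℕ → 𝕜) (f : ℕ → E →ₗ[𝕜] 𝕜) (y : ℕ → F),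
    Summable (fun n => ‖a n‖) ∧
    (∃ C : ℝ, ∀ n x, ‖f n x‖ ≤ C * q x) ∧
    (∃ D : ℝ, ∀ n, p (y n) ≤ D) ∧
    ∀ x, Tendsto (fun N => p (T x - ∑ n ∈ Finset.range N, a n • f n x • y n)) atTop (𝓝 0)

/-- A locally convex space `X` is nuclear: every continuous seminorm `p` is dominated by a
continuous seminorm `q` such that the identity `(X, q) → (X, p)` is nuclear. -/
def IsNuclearSpace (𝕜 X : Type*) [RCLike 𝕜] [AddCommGroup X] [Module 𝕜 X]
    [TopologicalSpace X] : Prop :=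
  ∀ p : Seminorm 𝕜 X, Continuous p →
    ∃ q : Seminorm 𝕜 X, Continuous q ∧ p ≤ q ∧ IsNuclearMap q p LinearMap.id

/-- The series `∑ x n` is unconditionally convergent: each of its rearrangements has convergent
partial sums. -/
def UnconditionallyConvergent {X : Type*} [AddCommGroup X] [TopologicalSpace X]
    (x : ℕ → X) : Prop :=
  ∀ π : Equiv.Perm ℕ, ∃ s : X,
    Tendsto (fun N => ∑ n ∈ Finset.range N, x (π n)) atTop (𝓝 s)

/-- The series `∑ x n` is absolutely convergent: `∑ p (x n) < ∞` for every continuous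
seminorm `p`. -/
def AbsolutelyConvergent (𝕜 : Type*) {X : Type*} [RCLike 𝕜] [AddCommGroup X] [Module 𝕜 X]
    [TopologicalSpace X] (x : ℕ → X) : Prop :=
  ∀ p : Seminorm 𝕜 X, Continuous p → Summable (fun n => p (x n))

/-! Forward direction. The finite sums of an unconditionally convergent series are bounded for every
continuous seminorm `q`; otherwise, some rearrangement would meet infinitely many blocks of `q`-size
greater than `1`. Functionals dominated by `q` are then uniformly absolutely summable along the
series, and integrating this over a nuclear representation gives `∑ p (x n) < ∞`
(`IsNuclearMap.summable`).

Converse. If `p` were absolutely summing with respect to no continuous seminorm, finite blocks with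
small finite sums but total `p`-mass `1` could be strung together into an unconditionally convergent
series that is not absolutely convergent (`exists_isAbsolutelySumming`). Pietsch domination replaces
a dominating seminorm by a Hilbertian one, an L² seminorm for a mean on the polar of its unit ball
(`IsAbsolutelySumming.exists_hilbertian`). Hence there are continuous Hilbertian `r ≥ q ≥ p` with
both inclusions absolutely summing. On Hilbert spaces such maps are Hilbert–Schmidt, and the
composition of two of these is nuclear (`IsAbsolutelySumming.isNuclearMap`). -/

/-! ### Rearrangements with prescribed initial segments -/

section Rearrangement

/-- The natural numbers can be enumerated in the order prescribed by an injective key. -/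
theorem exists_perm_of_injective_key {key : ℕ → ℕ} (hkey : Function.Injective key) :
    ∃ π : Equiv.Perm ℕ, ∀ (c : ℕ) (S : Finset ℕ), (∀ n, n ∈ S ↔ key n < c) →
      (Finset.range S.card).map π.toEmbedding = S := by
  classical
  set P : ℕ → Prop := fun k => k ∈ Set.range key with hP
  have hinf : (Set.ofPred P).Infinite := Set.infinite_range_of_injective hkey
  have hmem : ∀ n, ∃ k, key k = Nat.nth P n := fun n => Nat.nth_mem_of_infinite hinf n
  choose π hπ using hmem
  have hinj : Function.Injective π := fun a b hab => by
    apply Nat.nth_injective hinf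
    rw [← hπ, ← hπ, hab]
  have hsurj : Function.Surjective π := fun k => by
    have : key k ∈ Set.range (Nat.nth P) := by
      rw [Nat.range_nth_of_infinite hinf]; exact ⟨k, rfl⟩
    obtain ⟨n, hn⟩ := this
    exact ⟨n, hkey ((hπ n).trans hn)⟩
  refine ⟨Equiv.ofBijective π ⟨hinj, hsurj⟩, fun c S hS => ?_⟩
  have key1 : (Finset.range (Nat.count P c)).map
      (Equiv.ofBijective π ⟨hinj, hsurj⟩).toEmbedding = S := by
    ext k
    simp only [Finset.mem_map, Finset.mem_range, hS]
    constructor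
    · rintro ⟨n, hn, rfl⟩
      change key (π n) < c
      rw [hπ]
      exact Nat.nth_lt_of_lt_count hn
    · intro hk
      obtain ⟨n, rfl⟩ := hsurj k
      refine ⟨n, ?_, rfl⟩
      by_contra hn
      rw [not_lt, Nat.count_le_iff_le_nth hinf, ← hπ] at hn
      omega
  have hcard := congrArg Finset.card key1
  rw [Finset.card_map, Finset.card_range] at hcard
  rw [← hcard, key1]

/-- The left end point of the interval containing a given number, for the partition of `ℕ` into
consecutive intervals `[m, hi m)`. -/
def intervalStart (hi : ℕ → ℕ) : ℕ → ℕ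
  | 0 => 0
  | n + 1 => if n + 1 = hi (intervalStart hi n) then n + 1 else intervalStart hi n

variable {hi : ℕ → ℕ}

theorem intervalStart_le_and_lt (hhi : ∀ m, m < hi m) (n : ℕ) :
    intervalStart hi n ≤ n ∧ n < hi (intervalStart hi n) := by
  induction n with
  | zero => exact ⟨le_rfl, hhi 0⟩
  | succ n ih =>
    rw [intervalStart]
    split_ifs with h
    · exact ⟨le_rfl, hhi _⟩
    · omega

theorem intervalStart_eq_or_le (hhi : ∀ m, m < hi m) {k n : ℕ} (hkn : k ≤ n) :
    intervalStart hi k = intervalStart hi n ∨ hi (intervalStart hi k) ≤ intervalStart hi n := by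
  induction n, hkn using Nat.le_induction with
  | base => exact Or.inl rfl
  | succ n hkn ih =>
    have h1 := intervalStart_le_and_lt hhi n
    rw [intervalStart]
    split_ifs with h
    · right
      rcases ih with ih | ih
      · rw [ih]; exact h.ge
      · omega
    · exact ih

/-- The end of the interval containing `N` is itself a left end point, so left end points are
unbounded. -/
theorem exists_intervalStart_eq (hhi : ∀ m, m < hi m) (N : ℕ) :
    ∃ m, N ≤ m ∧ intervalStart hi m = m := by
  have hlt := intervalStart_le_and_lt hhi N
  have hconst : ∀ k, N + k < hi (intervalStart hi N) →
      intervalStart hi (N + k) = intervalStart hi N := by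
    intro k hk
    rcases intervalStart_eq_or_le hhi (Nat.le_add_right N k) with h | h
    · exact h.symm
    · have := (intervalStart_le_and_lt hhi (N + k)).1
      omega
  obtain ⟨k, hk⟩ : ∃ k, hi (intervalStart hi N) = N + k + 1 :=
    ⟨hi (intervalStart hi N) - N - 1, by omega⟩
  refine ⟨N + k + 1, by omega, ?_⟩
  rw [intervalStart, hconst k (by omega), if_pos hk.symm]

/-- Given finite sets `B m ⊆ [m, ∞)`, some rearrangement runs, for arbitrarily large `m`, first
through `[0, m)` and then through `B m`. -/
theorem exists_perm_initial_segments (B : ℕ → Finset ℕ) (hB : ∀ m, ∀ n ∈ B m, m ≤ n) :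
    ∃ π : Equiv.Perm ℕ, ∀ N, ∃ m, N ≤ m ∧ (Finset.range m).map π.toEmbedding = Finset.range m ∧
      (Finset.range (m + (B m).card)).map π.toEmbedding = Finset.range m ∪ B m := by
  classical
  set hi : ℕ → ℕ := fun m => max m ((B m).sup id) + 1 with hhi_def
  have hhi : ∀ m, m < hi m := fun m => Nat.lt_succ_of_le (le_max_left _ _)
  have hBhi : ∀ m, ∀ n ∈ B m, n < hi m := fun m n hn =>
    Nat.lt_succ_of_le ((Finset.le_sup (f := id) hn).trans (le_max_right _ _))
  set lo := intervalStart hi with hlo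
  have hlt : ∀ n, lo n ≤ n ∧ n < hi (lo n) := intervalStart_le_and_lt hhi
  have hcmp : ∀ {k n}, k ≤ n → lo k = lo n ∨ hi (lo k) ≤ lo n := intervalStart_eq_or_le hhi
  -- On an interval `[m, hi m)` the keys of `B m` lie in `[2m, m + hi m)` and the others in `[m + hi
  -- m, 2 * hi m)`. So intervals keep their order, `B m` comes first within its own, and the
  -- thresholds `m + m` and `m + hi m` cut out the two required segments.
  set key : ℕ → ℕ := fun n => if n ∈ B (lo n) then lo n + n else hi (lo n) + n with hkey_def
  have hkey1 : ∀ n, lo n + n ≤ key n ∧ key n ≤ hi (lo n) + n := fun n => by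
    have := hlt n
    simp only [hkey_def]
    split_ifs <;> omega
  have hne : ∀ k n, k < n → key k ≠ key n := by
    intro k n hkn
    have hk := hlt k
    have hn := hlt n
    rcases hcmp hkn.le with h | h
    · simp only [hkey_def]
      rw [← h] at hn ⊢
      split_ifs <;> omega
    · have := hkey1 k
      have := hkey1 n
      omega
  have hinj : Function.Injective key := fun a b hab => by
    by_contra h
    rcases Nat.lt_or_gt_of_ne h with h | h
    · exact hne a b h hab
    · exact hne b a h hab.symm
  obtain ⟨π, hπ⟩ := exists_perm_of_injective_key hinj
  refine ⟨π, fun N => ?_⟩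
  obtain ⟨m, hNm, hm⟩ := exists_intervalStart_eq hhi N
  rw [← hlo] at hm
  have hsmall : ∀ n, n < m → key n < m + m := fun n hn => by
    have h1 := hkey1 n
    have h2 := hlt n
    rcases hcmp hn.le with h | h <;> omega
  have hlarge : ∀ n, m ≤ n → m ≤ lo n := fun n hn => by
    have h2 := hhi m
    rcases hcmp hn with h | h <;> rw [hm] at h <;> omega
  refine ⟨m, hNm, ?_, ?_⟩
  · have := hπ (m + m) (Finset.range m) fun n => by
      rw [Finset.mem_range]
      refine ⟨hsmall n, fun h => ?_⟩
      by_contra hn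
      have h1 := hkey1 n
      have h2 := hlarge n (by omega)
      omega
    rwa [Finset.card_range] at this
  · have hdisj : Disjoint (Finset.range m) (B m) := by
      rw [Finset.disjoint_left]
      intro n hn hn'
      have := hB m n hn'
      rw [Finset.mem_range] at hn
      omega
    have := hπ (m + hi m) (Finset.range m ∪ B m) fun n => by
      rw [Finset.mem_union, Finset.mem_range]
      constructor
      · rintro (h | h)
        · have := hsmall n h
          have := hhi m
          omega
        · have h1 := hlarge n (hB m n h)
          have h2 := hBhi m n h
          have h3 : lo n = m := by
            rcases hcmp (hB m n h) with h' | h'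
            · rw [hm] at h'; exact h'.symm
            · rw [hm] at h'
              have := (hlt n).1
              omega
          simp only [hkey_def, h3, if_pos h]
          omega
      · intro h
        by_contra hn
        push Not at hn
        have h1 := hlarge n hn.1
        rcases hcmp hn.1 with h' | h'
        · rw [hm] at h'
          simp only [hkey_def, ← h', if_neg hn.2] at h
          omega
        · rw [hm] at h'
          have := hkey1 n
          omega
    rwa [Finset.card_union_of_disjoint hdisj, Finset.card_range] at this

end Rearrangement

/-! ### Nuclear spaces: unconditional convergence implies absolute convergence -/

section Forward

variable {𝕜 X : Type*} [RCLike 𝕜] [AddCommGroup X] [Module 𝕜 X]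

theorem Seminorm.map_sum_le (q : Seminorm 𝕜 X) {ι : Type*} (s : Finset ι) (x : ι → X) :
    q (∑ k ∈ s, x k) ≤ ∑ k ∈ s, q (x k) :=
  Finset.le_sum_of_subadditive q (map_zero q).le (map_add_le_add q) s x

/-- The finite sums of an unconditionally convergent series are bounded for every continuous
seminorm. -/
theorem UnconditionallyConvergent.exists_bound [TopologicalSpace X] [IsTopologicalAddGroup X]
    {x : ℕ → X} (hx : UnconditionallyConvergent x) (q : Seminorm 𝕜 X) (hq : Continuous q) :
    ∃ M : ℝ, ∀ t : Finset ℕ, q (∑ k ∈ t, x k) ≤ M := by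
  classical
  by_contra hcon
  push Not at hcon
  have hblock : ∀ m, ∃ B : Finset ℕ, (∀ n ∈ B, m ≤ n) ∧ 1 < q (∑ k ∈ B, x k) := by
    intro m
    obtain ⟨t, ht⟩ := hcon ((∑ k ∈ Finset.range m, q (x k)) + 1)
    refine ⟨t.filter (m ≤ ·), fun n hn => (Finset.mem_filter.1 hn).2, ?_⟩
    have h1 : ∑ k ∈ t, x k = ∑ k ∈ t.filter (m ≤ ·), x k + ∑ k ∈ t.filter (¬ m ≤ ·), x k :=
      (Finset.sum_filter_add_sum_filter_not _ _ _).symm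
    have h2 : q (∑ k ∈ t.filter (¬ m ≤ ·), x k) ≤ ∑ k ∈ Finset.range m, q (x k) := by
      refine (Seminorm.map_sum_le q _ _).trans
        (Finset.sum_le_sum_of_subset_of_nonneg (fun k hk => ?_) fun _ _ _ => apply_nonneg q _)
      have := (Finset.mem_filter.1 hk).2
      exact Finset.mem_range.2 (by omega)
    have h3 := map_add_le_add q (∑ k ∈ t.filter (m ≤ ·), x k) (∑ k ∈ t.filter (¬ m ≤ ·), x k)
    rw [← h1] at h3
    linarith
  choose B hB hqB using hblock
  obtain ⟨π, hπ⟩ := exists_perm_initial_segments B hB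
  obtain ⟨s, hs⟩ := hx π
  have hlim : Tendsto (fun N => q ((∑ n ∈ Finset.range N, x (π n)) - s)) atTop (𝓝 0) := by
    have := (hq.tendsto 0).comp (tendsto_sub_nhds_zero_iff.2 hs)
    rwa [map_zero] at this
  -- Two partial sums within `1 / 2` of the limit differ by less than `1`, yet the sum over `B m` is
  -- such a difference.
  obtain ⟨N, hN⟩ := eventually_atTop.1 (hlim.eventually (gt_mem_nhds (show (0 : ℝ) < 1 / 2 by norm_num)))
  obtain ⟨m, hNm, h1, h2⟩ := hπ N
  have e1 : ∑ n ∈ Finset.range m, x (π n) = ∑ n ∈ Finset.range m, x n := by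
    conv_rhs => rw [← h1, Finset.sum_map]
    rfl
  have e2 : ∑ n ∈ Finset.range (m + (B m).card), x (π n) =
      ∑ n ∈ Finset.range m, x n + ∑ n ∈ B m, x n := by
    rw [← Finset.sum_union, ← h2, Finset.sum_map]
    · rfl
    · rw [Finset.disjoint_left]
      intro n hn hn'
      have := hB m n hn'
      rw [Finset.mem_range] at hn
      omega
  have b1 := hN m hNm
  have b2 := hN (m + (B m).card) (by omega)
  rw [e1] at b1
  rw [e2] at b2
  have b3 := map_sub_le_add q (∑ n ∈ Finset.range m, x n + ∑ n ∈ B m, x n - s)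
    (∑ n ∈ Finset.range m, x n - s)
  rw [sub_sub_sub_cancel_right, add_sub_cancel_left] at b3
  have := hqB m
  linarith

/-- The nonnegative and the negative terms each form a subfamily, contributing at most `M`. -/
theorem sum_abs_le_of_abs_sum_le {ι : Type*} {s : Finset ι} {z : ι → ℝ} {M : ℝ}
    (h : ∀ t ⊆ s, |∑ k ∈ t, z k| ≤ M) : ∑ k ∈ s, |z k| ≤ 2 * M := by
  classical
  rw [← Finset.sum_filter_add_sum_filter_not s (fun k => 0 ≤ z k)]
  have h1 : ∑ k ∈ s.filter (fun k => 0 ≤ z k), |z k| ≤ M := by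
    refine le_trans (le_of_eq (Finset.sum_congr rfl fun k hk => ?_))
      ((le_abs_self _).trans (h _ (Finset.filter_subset _ _)))
    exact abs_of_nonneg (Finset.mem_filter.1 hk).2
  have h2 : ∑ k ∈ s.filter (fun k => ¬ 0 ≤ z k), |z k| ≤ M := by
    refine le_trans (le_of_eq ?_) ((neg_le_abs _).trans
      (h (s.filter (fun k => ¬ 0 ≤ z k)) (Finset.filter_subset _ _)))
    rw [← Finset.sum_neg_distrib]
    refine Finset.sum_congr rfl fun k hk => ?_
    exact abs_of_neg (not_le.1 (Finset.mem_filter.1 hk).2)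
  linarith

theorem sum_norm_le_of_norm_sum_le {ι : Type*} {s : Finset ι} {z : ι → 𝕜} {M : ℝ}
    (h : ∀ t ⊆ s, ‖∑ k ∈ t, z k‖ ≤ M) : ∑ k ∈ s, ‖z k‖ ≤ 4 * M := by
  have hre : ∑ k ∈ s, |RCLike.re (z k)| ≤ 2 * M := sum_abs_le_of_abs_sum_le fun t ht => by
    rw [← map_sum]
    exact (RCLike.abs_re_le_norm _).trans (h t ht)
  have him : ∑ k ∈ s, |RCLike.im (z k)| ≤ 2 * M := sum_abs_le_of_abs_sum_le fun t ht => by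
    rw [← map_sum]
    exact (RCLike.abs_im_le_norm _).trans (h t ht)
  have hz : ∀ w : 𝕜, ‖w‖ ≤ |RCLike.re w| + |RCLike.im w| := fun w => by
    have h1 := RCLike.norm_sq_eq_def (z := w)
    have h2 := mul_nonneg (abs_nonneg (RCLike.re w)) (abs_nonneg (RCLike.im w))
    refine abs_le_of_sq_le_sq' ?_ (by positivity) |>.2
    rw [h1, add_sq, sq_abs, sq_abs]
    nlinarith
  have := Finset.sum_le_sum fun k (_ : k ∈ s) => hz (z k)
  rw [Finset.sum_add_distrib] at this
  linarith

/-- A nuclear map sends families with bounded finite sums to absolutely summable families. -/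
theorem IsNuclearMap.summable {F : Type*} [AddCommGroup F] [Module 𝕜 F] {q : Seminorm 𝕜 X}
    {p : Seminorm 𝕜 F} {T : X →ₗ[𝕜] F} (hT : IsNuclearMap q p T) {x : ℕ → X} {M : ℝ}
    (hx : ∀ t : Finset ℕ, q (∑ k ∈ t, x k) ≤ M) : Summable fun k => p (T (x k)) := by
  obtain ⟨a, f, y, ha, ⟨C, hC⟩, ⟨D, hD⟩, hlim⟩ := hT
  have hD0 : 0 ≤ D := (apply_nonneg p _).trans (hD 0)
  have hM0 : 0 ≤ M := (apply_nonneg q _).trans (hx ∅)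
  have hf : ∀ n (s : Finset ℕ), ∑ k ∈ s, ‖f n (x k)‖ ≤ 4 * (|C| * M) := fun n s =>
    sum_norm_le_of_norm_sum_le fun t _ => by
      rw [← map_sum]
      refine (hC n _).trans ((mul_le_mul_of_nonneg_right (le_abs_self C) (apply_nonneg q _)).trans
        (mul_le_mul_of_nonneg_left (hx t) (abs_nonneg C)))
  refine summable_of_sum_le (c := (∑' n, ‖a n‖) * (4 * (|C| * M) * D))
    (fun k => apply_nonneg p _) fun s => ?_
  have hlim' : Tendsto (fun N => ∑ k ∈ s, p (T (x k) - ∑ n ∈ Finset.range N, a n • f n (x k) • y n) +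
      (∑' n, ‖a n‖) * (4 * (|C| * M) * D)) atTop (𝓝 (∑ k ∈ s, 0 + (∑' n, ‖a n‖) * (4 * (|C| * M) * D))) :=
    (tendsto_finsetSum s fun k _ => hlim (x k)).add tendsto_const_nhds
  rw [Finset.sum_const_zero, zero_add] at hlim'
  refine ge_of_tendsto' hlim' fun N => ?_
  -- Split off the remainder of the nuclear series: over the finite set `s` the remainders tend to
  -- `0` with `N`, while the main terms are bounded uniformly in `N` after summing over `k` first.
  have h1 : ∀ k, p (T (x k)) ≤ p (T (x k) - ∑ n ∈ Finset.range N, a n • f n (x k) • y n) +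
      ∑ n ∈ Finset.range N, ‖a n‖ * (‖f n (x k)‖ * D) := fun k => by
    have h2 := map_add_le_add p (T (x k) - ∑ n ∈ Finset.range N, a n • f n (x k) • y n)
      (∑ n ∈ Finset.range N, a n • f n (x k) • y n)
    rw [sub_add_cancel] at h2
    refine h2.trans (add_le_add_right ((Seminorm.map_sum_le p _ _).trans
      (Finset.sum_le_sum fun n _ => ?_)) _)
    rw [map_smul_eq_mul, map_smul_eq_mul]
    gcongr
    exact hD n
  refine (Finset.sum_le_sum fun k _ => h1 k).trans ?_
  rw [Finset.sum_add_distrib]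
  gcongr
  rw [Finset.sum_comm]
  calc ∑ n ∈ Finset.range N, ∑ k ∈ s, ‖a n‖ * (‖f n (x k)‖ * D)
      = ∑ n ∈ Finset.range N, ‖a n‖ * ((∑ k ∈ s, ‖f n (x k)‖) * D) := by
        simp only [Finset.mul_sum, Finset.sum_mul]
    _ ≤ ∑ n ∈ Finset.range N, ‖a n‖ * (4 * (|C| * M) * D) := by
        gcongr with n _
        exact hf n s
    _ = (∑ n ∈ Finset.range N, ‖a n‖) * (4 * (|C| * M) * D) := by rw [Finset.sum_mul]
    _ ≤ _ := by
        gcongr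
        exact ha.sum_le_tsum _ fun n _ => norm_nonneg _

theorem IsNuclearSpace.absolutelyConvergent [TopologicalSpace X] [IsTopologicalAddGroup X]
    (hX : IsNuclearSpace 𝕜 X) {x : ℕ → X} (hx : UnconditionallyConvergent x) :
    AbsolutelyConvergent 𝕜 x := fun p hp => by
  obtain ⟨q, hq, -, hT⟩ := hX p hp
  obtain ⟨M, hM⟩ := hx.exists_bound q hq
  exact hT.summable hM

end Forward

/-! ### Absolutely summing seminorms from the series hypothesis -/

section Summing

/-- `p` is absolutely summing with respect to `q`: if all partial sums of a finite family are
bounded by `M` for `q`, then the sum of the values of `p` is at most `M`. -/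
def IsAbsolutelySumming {𝕜 E : Type*} [RCLike 𝕜] [AddCommGroup E] [Module 𝕜 E]
    (q p : Seminorm 𝕜 E) : Prop :=
  ∀ (n : ℕ) (x : Fin n → E) (M : ℝ), (∀ t : Finset (Fin n), q (∑ k ∈ t, x k) ≤ M) →
    ∑ k, p (x k) ≤ M

variable {𝕜 X : Type*} [RCLike 𝕜] [AddCommGroup X] [Module 𝕜 X]

theorem IsAbsolutelySumming.mono_left {q q' p : Seminorm 𝕜 X} (h : IsAbsolutelySumming q p)
    (hq : q ≤ q') : IsAbsolutelySumming q' p :=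
  fun n x M hM => h n x M fun t => (hq _).trans (hM t)

/-- A violating family is divided by its total `p`-mass, which exceeds the bound `M` on its finite
sums. -/
theorem exists_block_of_not_isAbsolutelySumming {q p : Seminorm 𝕜 X}
    (h : ¬ IsAbsolutelySumming q p) :
    ∃ (n : ℕ) (y : Fin n → X), (∀ t : Finset (Fin n), q (∑ k ∈ t, y k) ≤ 1) ∧
      ∑ k, p (y k) = 1 := by
  simp only [IsAbsolutelySumming, not_forall, not_le] at h
  obtain ⟨n, x, M, hM, hlt⟩ := h
  have hM0 : 0 ≤ M := (apply_nonneg q _).trans (hM ∅)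
  set P := ∑ k, p (x k)
  have hP : 0 < P := hM0.trans_lt hlt
  have hnorm : ‖((P⁻¹ : ℝ) : 𝕜)‖ = P⁻¹ := by
    rw [RCLike.norm_ofReal, abs_of_pos (inv_pos.2 hP)]
  refine ⟨n, fun k => ((P⁻¹ : ℝ) : 𝕜) • x k, fun t => ?_, ?_⟩
  · rw [← Finset.smul_sum, map_smul_eq_mul, hnorm, inv_mul_le_iff₀ hP, mul_one]
    exact (hM t).trans hlt.le
  · simp only [map_smul_eq_mul, hnorm]
    rw [← Finset.mul_sum, inv_mul_cancel₀ hP.ne']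

theorem Seminorm.continuous_finset_sup [TopologicalSpace X] {ι : Type*} (s : Finset ι)
    {r : ι → Seminorm 𝕜 X} (hr : ∀ i, Continuous (r i)) : Continuous ⇑(s.sup r) := by
  classical
  induction s using Finset.induction_on with
  | empty => exact continuous_const
  | insert i s _ ih =>
    rw [Finset.sup_insert]
    exact (hr i).sup ih

theorem exists_monotone_continuous_seminorms [TopologicalSpace X] [FirstCountableTopology X]
    [PolynormableSpace 𝕜 X] :
    ∃ Q : ℕ → Seminorm 𝕜 X, Monotone Q ∧ (∀ j, Continuous (Q j)) ∧
      ∀ U ∈ 𝓝 (0 : X), ∃ j, (Q j).ball 0 1 ⊆ U := by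
  obtain ⟨U, hU⟩ := (𝓝 (0 : X)).exists_antitone_basis
  have hex : ∀ j, ∃ r : Seminorm 𝕜 X, Continuous r ∧ r.ball 0 1 ⊆ U j := fun j => by
    obtain ⟨s, ε, hε, hs⟩ := ((PolynormableSpace.withSeminorms 𝕜 X).mem_nhds_iff 0 _).1
      (hU.1.mem_of_mem (i := j) trivial)
    have hc : Continuous ⇑(s.sup fun r : {r : Seminorm 𝕜 X // Continuous r} => r.1) :=
      Seminorm.continuous_finset_sup s fun i => i.2
    refine ⟨(ε⁻¹).toNNReal • s.sup fun r : {r : Seminorm 𝕜 X // Continuous r} => r.1,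
      hc.const_smul _, fun x hx => hs ?_⟩
    rw [Seminorm.mem_ball_zero, smul_apply, NNReal.smul_def, smul_eq_mul,
      Real.coe_toNNReal _ (inv_pos.2 hε).le, inv_mul_lt_iff₀ hε, mul_one] at hx
    rwa [Seminorm.mem_ball_zero]
  choose r hr hrU using hex
  refine ⟨fun j => (Finset.range (j + 1)).sup r, fun i j hij => Finset.sup_mono ?_,
    fun j => Seminorm.continuous_finset_sup _ hr, fun V hV => ?_⟩
  · exact Finset.range_subset_range.2 (by omega)
  · obtain ⟨j, -, hj⟩ := hU.1.mem_iff.1 hV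
    refine ⟨j, fun x hx => hj (hrU j ?_)⟩
    rw [Seminorm.mem_ball_zero] at hx ⊢
    exact (Finset.le_sup (f := r) (Finset.self_mem_range_succ j) x).trans_lt hx

theorem exists_isAbsolutelySumming [UniformSpace X] [IsUniformAddGroup X] [CompleteSpace X]
    [FirstCountableTopology X] [PolynormableSpace 𝕜 X]
    (h : ∀ x : ℕ → X, UnconditionallyConvergent x → AbsolutelyConvergent 𝕜 x)
    {p : Seminorm 𝕜 X} (hp : Continuous p) :
    ∃ q : Seminorm 𝕜 X, Continuous q ∧ IsAbsolutelySumming q p := by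
  classical
  by_contra hcon
  push Not at hcon
  obtain ⟨Q, hQmono, hQ, hQU⟩ := exists_monotone_continuous_seminorms (𝕜 := 𝕜) (X := X)
  -- The factor `2 ^ j` makes the finite sums of block `j` at most `2 ^ (-j)` for `Q j`, while its
  -- `p`-mass stays `1`.
  have hblock := fun j => exists_block_of_not_isAbsolutelySumming
    (hcon ((2 ^ j : NNReal) • Q j) ((hQ j).const_smul _))
  choose n y hyq hyp using hblock
  replace hyq : ∀ j t, Q j (∑ k ∈ t, y j k) ≤ (1 / 2) ^ j := fun j t => by
    have := hyq j t
    rw [smul_apply, NNReal.smul_def, smul_eq_mul, NNReal.coe_pow] at this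
    rw [one_div, inv_pow, ← one_div, le_div_iff₀' (by positivity)]
    exact_mod_cast this
  set z : (Σ j, Fin (n j)) → X := fun a => y a.1 a.2 with hz
  have hsum : Summable z := by
    -- Completeness reduces summability to a Cauchy criterion. A finite set avoiding the early
    -- blocks splits along the later ones, and its sum is controlled by a geometric tail because `Q
    -- i ≤ Q j` for `i ≤ j`.
    rw [summable_iff_vanishing]
    intro e he
    obtain ⟨i, hi⟩ := hQU e he
    obtain ⟨s, hs⟩ := summable_iff_vanishing_norm.1 summable_geometric_two 1 one_pos
    refine ⟨(s ∪ Finset.range i).sigma fun _ => Finset.univ, fun t ht => hi ?_⟩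
    rw [Seminorm.mem_ball_zero]
    set T := t.image Sigma.fst with hT
    set f : ∀ j, Finset (Fin (n j)) := fun j => Finset.univ.filter fun k => (⟨j, k⟩ : Σ j, Fin (n j)) ∈ t
    have htT : t = T.sigma f := by
      ext ⟨j, k⟩
      simp only [Finset.mem_sigma, hT, Finset.mem_image, f, Finset.mem_filter, Finset.mem_univ,
        true_and]
      exact ⟨fun h => ⟨⟨_, h, rfl⟩, h⟩, fun h => h.2⟩
    have hTs : ∀ j ∈ T, j ∉ s ∧ i ≤ j := by
      intro j hj
      obtain ⟨a, ha, rfl⟩ := Finset.mem_image.1 hj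
      have := Finset.disjoint_left.1 ht ha
      simp only [Finset.mem_sigma, Finset.mem_union, Finset.mem_range, Finset.mem_univ, and_true,
        not_or, not_lt] at this
      exact this
    rw [htT, Finset.sum_sigma]
    calc Q i (∑ j ∈ T, ∑ k ∈ f j, y j k) ≤ ∑ j ∈ T, Q i (∑ k ∈ f j, y j k) :=
          Seminorm.map_sum_le _ _ _
      _ ≤ ∑ j ∈ T, (1 / 2 : ℝ) ^ j :=
          Finset.sum_le_sum fun j hj => (hQmono (hTs j hj).2 _).trans (hyq j _)
      _ ≤ ‖∑ j ∈ T, (1 / 2 : ℝ) ^ j‖ := Real.le_norm_self _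
      _ < 1 := hs T (Finset.disjoint_left.2 fun j hj => (hTs j hj).1)
  -- The blocks are placed in one sequence, padded with zeros off the range of the encoding.
  set x : ℕ → X := Function.extend Encodable.encode z 0 with hx
  have hxsum : Summable x := (summable_extend_zero Encodable.encode_injective).2 hsum
  have hps : Summable fun k => p (x k) := h x (fun π =>
    ⟨_, ((π.summable_iff (f := x)).2 hxsum).hasSum.tendsto_sum_nat⟩) p hp
  have hps' : Summable fun a => p (z a) := by
    refine (hps.comp_injective (Encodable.encode_injective (α := Σ j, Fin (n j)))).congr fun a => ?_
    simp only [Function.comp, hx, Encodable.encode_injective.extend_apply]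
  have h1 := hps'.sigma
  simp only [tsum_fintype, hz, hyp] at h1
  exact one_ne_zero ((summable_const_iff _).1 h1)

end Summing

/-! ### Pietsch domination -/

section PietschDomination

open scoped BoundedContinuousFunction

/-- **Pietsch domination**, for a finitely additive mean in place of a measure. -/
theorem exists_positive_functional {K E : Type*} [TopologicalSpace K] [DiscreteTopology K]
    [Nonempty K] (φ : E → K →ᵇ ℝ) (p : E → ℝ)
    (hsmul : ∀ c : ℝ, 0 ≤ c → ∀ x, ∃ y, φ y = c • φ x ∧ p y = c * p x)
    (hsum : ∀ (n : ℕ) (x : Fin n → E) (M : ℝ), (∀ k, ∑ i, φ (x i) k ≤ M) → ∑ i, p (x i) ≤ M) :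
    ∃ Λ : (K →ᵇ ℝ) →ₗ[ℝ] ℝ, (∀ g, (∀ k, 0 ≤ g k) → 0 ≤ Λ g) ∧ Λ 1 = 1 ∧ ∀ x, p x ≤ Λ (φ x) := by
  -- The cone is chosen so that positivity on it gives everything: nonnegative functions belong to
  -- it through the empty family, and `φ x - p x • 1` through the family consisting of `x`.
  let C : PointedCone ℝ (K →ᵇ ℝ) :=
    { carrier := {g | ∃ (n : ℕ) (x : Fin n → E), ∀ k, ∑ i, φ (x i) k ≤ g k + ∑ i, p (x i)}
      zero_mem' := ⟨0, Fin.elim0, fun k => by simp⟩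
      add_mem' := by
        rintro g g' ⟨n, x, hx⟩ ⟨n', x', hx'⟩
        refine ⟨n + n', Fin.append x x', fun k => ?_⟩
        simp only [Fin.sum_univ_add, Fin.append_left, Fin.append_right]
        have := hx k
        have := hx' k
        simp only [BoundedContinuousFunction.coe_add, Pi.add_apply]
        linarith
      smul_mem' := by
        rintro ⟨c, hc⟩ g ⟨n, x, hx⟩
        choose y hy using hsmul c hc
        refine ⟨n, fun i => y (x i), fun k => ?_⟩
        have := mul_le_mul_of_nonneg_left (hx k) hc
        simp only [fun i => (hy (x i)).1, fun i => (hy (x i)).2, ← Finset.mul_sum]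
        rw [mul_add] at this
        simpa [← Finset.mul_sum] using this }
  have h1 : (1 : K →ᵇ ℝ) ≠ 0 := fun h =>
    one_ne_zero (congrArg (fun g : K →ᵇ ℝ => g (Classical.arbitrary K)) h)
  -- The functional `c • 1 ↦ c` is extended. If `c • 1` is in the cone, `hsum` with `M = c + ∑ i, p
  -- (x i)` forces `0 ≤ c`; adding `‖g‖ • 1` brings any `g` into the cone.
  obtain ⟨Λ, hΛ1, hΛ⟩ := riesz_extension C (LinearPMap.mkSpanSingleton (1 : K →ᵇ ℝ) (1 : ℝ) h1)
    (by
      rintro ⟨g, hg⟩ hgC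
      obtain ⟨c, rfl⟩ := Submodule.mem_span_singleton.1 hg
      obtain ⟨n, x, hx⟩ := hgC
      erw [LinearPMap.mkSpanSingleton'_apply]
      have := hsum n x (c + ∑ i, p (x i)) fun k => by simpa using hx k
      simp
      linarith)
    (fun g => by
      refine ⟨⟨‖g‖ • 1, Submodule.mem_span_singleton.2 ⟨_, rfl⟩⟩, 0, Fin.elim0, fun k => ?_⟩
      have := (abs_le.1 (g.norm_coe_le_norm k)).1
      simp
      linarith)
  have hone : Λ 1 = 1 := by
    have := hΛ1 ⟨1, Submodule.mem_span_singleton_self _⟩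
    rw [this]
    exact LinearPMap.mkSpanSingleton'_apply_self _ _ _ _
  refine ⟨Λ, fun g hg => hΛ g ⟨0, Fin.elim0, fun k => by simpa using hg k⟩, hone, fun x => ?_⟩
  have := hΛ (φ x - p x • 1) ⟨1, fun _ => x, fun k => by simp⟩
  rw [map_sub, map_smul, hone] at this
  simpa using this

end PietschDomination

/-! ### Completions of seminormed spaces -/

section Completion

universe u v

variable {𝕜 : Type u} {X : Type v} [RCLike 𝕜] [AddCommGroup X] [Module 𝕜 X]

/-- The completion of a seminormed space. -/
theorem Seminorm.exists_completion (p : Seminorm 𝕜 X) :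
    ∃ (Y : Type v) (_ : NormedAddCommGroup Y) (_ : NormedSpace 𝕜 Y) (_ : CompleteSpace Y)
      (T : X →ₗ[𝕜] Y), DenseRange T ∧ ∀ x, ‖T x‖ = p x := by
  let _ : SeminormedAddCommGroup X := p.toAddGroupSeminorm.toSeminormedAddCommGroup
  let _ : NormedSpace 𝕜 X := ⟨fun c x => (map_smul_eq_mul p c x).le⟩
  exact ⟨UniformSpace.Completion X, inferInstance, inferInstance, inferInstance,
    (UniformSpace.Completion.toComplₗᵢ (𝕜 := 𝕜) (E := X)).toLinearMap,
    UniformSpace.Completion.denseRange_coe, fun x => UniformSpace.Completion.norm_coe x⟩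

/-- The completion for a Hilbertian seminorm is a Hilbert space. -/
theorem Seminorm.exists_hilbert_completion (p : Seminorm 𝕜 X)
    (hp : ∀ x y, p (x + y) * p (x + y) + p (x - y) * p (x - y) = 2 * (p x * p x + p y * p y)) :
    ∃ (H : Type v) (_ : NormedAddCommGroup H) (_ : InnerProductSpace 𝕜 H) (_ : CompleteSpace H)
      (T : X →ₗ[𝕜] H), DenseRange T ∧ ∀ x, ‖T x‖ = p x := by
  obtain ⟨Y, _, _, _, T, hT, hTp⟩ := p.exists_completion
  have hpar : ∀ x y : Y,
      ‖x + y‖ * ‖x + y‖ + ‖x - y‖ * ‖x - y‖ = 2 * (‖x‖ * ‖x‖ + ‖y‖ * ‖y‖) := fun x y => by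
    refine hT.induction_on₂ (p := fun x y : Y =>
      ‖x + y‖ * ‖x + y‖ + ‖x - y‖ * ‖x - y‖ = 2 * (‖x‖ * ‖x‖ + ‖y‖ * ‖y‖))
      (isClosed_eq (by fun_prop) (by fun_prop)) (fun a b => ?_) x y
    rw [← map_add, ← map_sub]
    simp only [hTp]
    exact hp a b
  exact ⟨Y, _, InnerProductSpace.ofNorm 𝕜 hpar, ‹_›, T, hT, hTp⟩

end Completion

/-! ### Hilbertian seminorms from Pietsch domination -/

section HilbertianSeminorm

open scoped BoundedContinuousFunction

variable {𝕜 X : Type*} [RCLike 𝕜] [AddCommGroup X] [Module 𝕜 X]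

theorem Seminorm.exists_functional_eq (q : Seminorm 𝕜 X) (x : X) :
    ∃ f : X →ₗ[𝕜] 𝕜, (∀ z, ‖f z‖ ≤ q z) ∧ ‖f x‖ = q x := by
  obtain ⟨Y, _, _, _, T, -, hT⟩ := q.exists_completion
  obtain ⟨g, hg, hgx⟩ := exists_dual_vector'' 𝕜 (T x)
  refine ⟨g.toLinearMap ∘ₗ T, fun z => ?_, ?_⟩
  · rw [← hT]
    exact g.le_of_opNorm_le hg (T z) |>.trans_eq (one_mul _)
  · rw [← hT]
    change ‖g (T x)‖ = _
    rw [hgx, RCLike.norm_ofReal, abs_of_nonneg (norm_nonneg _)]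

/-- The quadratic polynomial `t ↦ Λ ((a + t • b) * (a + t • b))` is nonnegative, so its discriminant
is at most `0`. -/
theorem cauchySchwarz_of_positive {K : Type*} [TopologicalSpace K] {Λ : (K →ᵇ ℝ) →ₗ[ℝ] ℝ}
    (hΛ : ∀ g, (∀ k, 0 ≤ g k) → 0 ≤ Λ g) (a b : K →ᵇ ℝ) :
    Λ (a * b) ^ 2 ≤ Λ (a * a) * Λ (b * b) := by
  have h : ∀ t : ℝ, 0 ≤ Λ (b * b) * (t * t) + (2 * Λ (a * b)) * t + Λ (a * a) := fun t => by
    have h1 := hΛ ((a + t • b) * (a + t • b)) fun k => mul_self_nonneg _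
    have h2 : (a + t • b) * (a + t • b) = (t * t) • (b * b) + (2 * t) • (a * b) + a * a := by
      ext k
      simp only [BoundedContinuousFunction.coe_mul, BoundedContinuousFunction.coe_add,
        BoundedContinuousFunction.coe_smul, Pi.mul_apply, Pi.add_apply, smul_eq_mul]
      ring
    rw [h2, map_add, map_add, map_smul, map_smul, smul_eq_mul, smul_eq_mul] at h1
    linarith
  have := discrim_le_zero h
  rw [discrim] at this
  nlinarith

/-- Between a seminorm and one for which it is absolutely summing there is a Hilbertian seminorm
that is `2`-summing. -/
theorem IsAbsolutelySumming.exists_hilbertian {q p : Seminorm 𝕜 X}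
    (h : IsAbsolutelySumming q p) :
    ∃ r : Seminorm 𝕜 X, p ≤ r ∧ r ≤ q ∧
      (∀ x y, r (x + y) * r (x + y) + r (x - y) * r (x - y) = 2 * (r x * r x + r y * r y)) ∧
      ∀ s : Finset X, (∀ f : X →ₗ[𝕜] 𝕜, (∀ x, ‖f x‖ ≤ q x) → ∑ x ∈ s, ‖f x‖ ^ 2 ≤ 1) →
        ∑ x ∈ s, r x ^ 2 ≤ 1 := by
  -- The polar of the unit ball of `q`. A finitely additive mean suffices, so it carries the
  -- discrete topology and no weak-* compactness is needed.
  let K := {f : X →ₗ[𝕜] 𝕜 // ∀ x, ‖f x‖ ≤ q x}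
  let _ : TopologicalSpace K := ⊥
  have : DiscreteTopology K := ⟨rfl⟩
  have : Nonempty K := ⟨⟨0, fun x => by simp⟩⟩
  let φ : X → K →ᵇ ℝ := fun x => BoundedContinuousFunction.mkOfDiscrete (fun f : K => ‖f.1 x‖) (q x)
    fun f g => by
      rw [Real.dist_eq, abs_le]
      have := f.2 x
      have := g.2 x
      have := norm_nonneg (f.1 x)
      have := norm_nonneg (g.1 x)
      constructor <;> linarith
  have hφ : ∀ x (f : K), φ x f = ‖f.1 x‖ := fun x f => rfl
  obtain ⟨Λ, hΛ, hΛ1, hpΛ⟩ := exists_positive_functional φ p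
    (fun c hc x => ⟨(c : 𝕜) • x, by
      ext f
      simp [hφ, abs_of_nonneg hc], by simp [map_smul_eq_mul, abs_of_nonneg hc]⟩)
    (fun n x M hM => h n x M fun t => by
      obtain ⟨f, hf, hft⟩ := q.exists_functional_eq (∑ k ∈ t, x k)
      rw [← hft, map_sum]
      refine (norm_sum_le _ _).trans (le_trans ?_ (hM ⟨f, hf⟩))
      exact Finset.sum_le_sum_of_subset_of_nonneg (Finset.subset_univ _) fun _ _ _ =>
        norm_nonneg _)
  have hmono : ∀ a b : K →ᵇ ℝ, (∀ k, a k ≤ b k) → Λ a ≤ Λ b := fun a b hab => by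
    have := hΛ (b - a) fun k => by simpa using hab k
    rw [map_sub] at this
    linarith
  have hconst : ∀ c : ℝ, Λ (c • 1) = c := fun c => by rw [map_smul, hΛ1, smul_eq_mul, mul_one]
  have hsq : ∀ a : K →ᵇ ℝ, 0 ≤ Λ (a * a) := fun a => hΛ _ fun k => mul_self_nonneg _
  -- The L² seminorm of `f ↦ ‖f x‖` for the mean `Λ`. The parallelogram law and the `2`-summing
  -- bound follow by applying `Λ` to their pointwise versions.
  let r : Seminorm 𝕜 X := Seminorm.of (fun x => Real.sqrt (Λ (φ x * φ x)))
    (fun x y => by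
      refine Real.sqrt_le_iff.2 ⟨by positivity, ?_⟩
      have h1 : Λ (φ (x + y) * φ (x + y)) ≤ Λ ((φ x + φ y) * (φ x + φ y)) := hmono _ _ fun f => by
        have : ‖f.1 (x + y)‖ ≤ ‖f.1 x‖ + ‖f.1 y‖ := by
          rw [map_add]
          exact norm_add_le _ _
        exact mul_self_le_mul_self (norm_nonneg (f.1 (x + y))) this
      have h2 : (φ x + φ y) * (φ x + φ y) = φ x * φ x + (2 : ℝ) • (φ x * φ y) + φ y * φ y := by
        rw [ofNat_smul_eq_nsmul, nsmul_eq_mul]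
        push_cast
        ring
      rw [h2, map_add, map_add, map_smul, smul_eq_mul] at h1
      have h3 := Real.abs_le_sqrt (cauchySchwarz_of_positive hΛ (φ x) (φ y))
      rw [Real.sqrt_mul (hsq _)] at h3
      rw [add_sq, Real.sq_sqrt (hsq _), Real.sq_sqrt (hsq _)]
      have := le_abs_self (Λ (φ x * φ y))
      linarith)
    (fun c x => by
      have h1 : φ (c • x) * φ (c • x) = (‖c‖ * ‖c‖) • (φ x * φ x) := by
        ext f
        simp [hφ]
        ring
      rw [h1, map_smul, smul_eq_mul, Real.sqrt_mul (mul_self_nonneg _),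
        Real.sqrt_mul_self (norm_nonneg _)])
  have hr : ∀ x, r x * r x = Λ (φ x * φ x) := fun x => Real.mul_self_sqrt (hsq _)
  refine ⟨r, fun x => ?_, fun x => ?_, fun x y => ?_, fun s hs => ?_⟩
  · refine (hpΛ x).trans (Real.le_sqrt_of_sq_le ?_)
    have := cauchySchwarz_of_positive hΛ (φ x) 1
    rwa [mul_one, mul_one, hΛ1, mul_one] at this
  · refine Real.sqrt_le_iff.2 ⟨apply_nonneg q x, ?_⟩
    rw [← hconst (q x ^ 2)]
    refine hmono _ _ fun f => ?_
    have := mul_self_le_mul_self (norm_nonneg _) (f.2 x)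
    simpa [hφ, sq] using this
  · simp only [hr]
    have h1 : φ (x + y) * φ (x + y) + φ (x - y) * φ (x - y) =
        (2 : ℝ) • (φ x * φ x + φ y * φ y) := by
      ext f
      simpa [hφ, mul_add] using parallelogram_law_with_norm_mul 𝕜 (f.1 x) (f.1 y)
    rw [← map_add, h1, map_smul, map_add, smul_eq_mul]
  · simp only [sq, hr]
    rw [← map_sum, ← hΛ1]
    refine hmono _ _ fun f => ?_
    simpa [hφ, sq] using hs f.1 f.2

end HilbertianSeminorm

/-! ### Absolutely summing and Hilbert–Schmidt operators -/

section HilbertSchmidt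

open scoped InnerProductSpace

variable {𝕜 X H H' Y : Type*} [RCLike 𝕜] [AddCommGroup X] [Module 𝕜 X]
  [NormedAddCommGroup H] [InnerProductSpace 𝕜 H]
  [NormedAddCommGroup H'] [InnerProductSpace 𝕜 H']
  [NormedAddCommGroup Y] [NormedSpace 𝕜 Y]

theorem IsAbsolutelySumming.le {q p : Seminorm 𝕜 X} (h : IsAbsolutelySumming q p) : p ≤ q := by
  intro x
  have := h 1 (fun _ => x) (q x) fun t => by
    rcases t.eq_empty_or_nonempty with rfl | ht
    · simp
    · obtain ⟨j, hj⟩ := ht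
      obtain rfl : t = Finset.univ := Finset.eq_univ_iff_forall.2 fun i => by
        rwa [Subsingleton.elim i j]
      simp
  simpa using this

/-- An absolutely summing inequality passes to the completions. -/
theorem IsAbsolutelySumming.extend {q p : Seminorm 𝕜 X} (h : IsAbsolutelySumming q p)
    {T : X →ₗ[𝕜] H} (hT : DenseRange T) (hTq : ∀ x, ‖T x‖ = q x) {B : H →L[𝕜] Y}
    (hB : ∀ x, ‖B (T x)‖ = p x) :
    IsAbsolutelySumming (normSeminorm 𝕜 H) ((normSeminorm 𝕜 Y).comp B.toLinearMap) := by
  intro n v M hM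
  have hlim : Tendsto (fun ε : ℝ => M + n * ε + ∑ _k : Fin n, ‖B‖ * ε) (𝓝[>] 0) (𝓝 M) := by
    have : Tendsto (fun ε : ℝ => M + n * ε + ∑ _k : Fin n, ‖B‖ * ε) (𝓝 0)
        (𝓝 (M + n * 0 + ∑ _k : Fin n, ‖B‖ * 0)) :=
      Continuous.tendsto (by fun_prop) 0
    simp only [mul_zero, Finset.sum_const_zero, add_zero] at this
    exact this.mono_left nhdsWithin_le_nhds
  refine ge_of_tendsto hlim (eventually_nhdsWithin_of_forall fun ε hε => ?_)
  have happrox : ∀ k, ∃ u : X, ‖v k - T u‖ < ε := fun k => by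
    obtain ⟨u, hu⟩ := hT.exists_dist_lt (v k) hε
    exact ⟨u, by rwa [← dist_eq_norm]⟩
  choose u hu using happrox
  have h1 : ∑ k, p (u k) ≤ M + n * ε := h n u _ fun t => by
    rw [← hTq, map_sum]
    have h2 : ‖∑ k ∈ t, v k - ∑ k ∈ t, T (u k)‖ ≤ n * ε := by
      rw [← Finset.sum_sub_distrib]
      refine (norm_sum_le _ _).trans ((Finset.sum_le_sum fun k _ => (hu k).le).trans ?_)
      rw [Finset.sum_const, nsmul_eq_mul]
      have : t.card ≤ n := by simpa using Finset.card_le_univ t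
      have hε' : (0 : ℝ) ≤ ε := le_of_lt hε
      gcongr
    have h3 := norm_sub_norm_le (∑ k ∈ t, T (u k)) (∑ k ∈ t, v k)
    rw [norm_sub_rev] at h3
    have h4 : ‖∑ k ∈ t, v k‖ ≤ M := hM t
    linarith
  have h5 : ∀ k, ‖B (v k)‖ ≤ p (u k) + ‖B‖ * ε := fun k => by
    have h6 := norm_sub_norm_le (B (v k)) (B (T (u k)))
    rw [← map_sub, hB] at h6
    have h7 := B.le_opNorm (v k - T (u k))
    have h8 := mul_le_mul_of_nonneg_left (hu k).le (norm_nonneg B)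
    linarith
  have h9 := Finset.sum_le_sum fun k (_ : k ∈ Finset.univ) => h5 k
  rw [Finset.sum_add_distrib] at h9
  change ∑ k, ‖B (v k)‖ ≤ _
  linarith

/-- Absolutely summing operators on a Hilbert space are Hilbert–Schmidt. -/
theorem sum_sq_norm_le_of_isAbsolutelySumming [CompleteSpace H] {B : H →L[𝕜] Y}
    (h : IsAbsolutelySumming (normSeminorm 𝕜 H) ((normSeminorm 𝕜 Y).comp B.toLinearMap))
    {ι : Type*} {v : ι → H} (hv : Orthonormal 𝕜 v) (s : Finset ι) :
    ∑ i ∈ s, ‖B (v i)‖ ^ 2 ≤ 1 := by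
  obtain ⟨r, hpr, -, -, hr⟩ := h.exists_hilbertian
  have hinj : Function.Injective v := hv.linearIndependent.injective
  -- By Riesz representation `f` is the inner product with a vector of norm at most `1`, and
  -- Bessel's inequality gives the hypothesis of the `2`-summing bound.
  have h1 := hr (s.map ⟨v, hinj⟩) fun f hf => by
    rw [Finset.sum_map]
    set F : StrongDual 𝕜 H := f.mkContinuous 1 fun x => by simpa using hf x
    have hF : ‖F‖ ≤ 1 := f.mkContinuous_norm_le zero_le_one _
    set w := (InnerProductSpace.toDual 𝕜 H).symm F with hw
    have hwn : ‖w‖ ≤ 1 := by rwa [hw, LinearIsometryEquiv.norm_map]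
    refine le_trans (le_of_eq (Finset.sum_congr rfl fun i _ => ?_))
      ((hv.sum_inner_products_le w (s := s)).trans (pow_le_one₀ (norm_nonneg _) hwn))
    rw [norm_inner_symm, hw, InnerProductSpace.toDual_symm_apply]
    rfl
  rw [Finset.sum_map] at h1
  refine le_trans (Finset.sum_le_sum fun i _ => ?_) h1
  exact pow_le_pow_left₀ (norm_nonneg _) (hpr (v i)) 2

/-- The composition of two Hilbert–Schmidt operators is nuclear. -/
theorem exists_nuclear_representation_comp [CompleteSpace H] [CompleteSpace H'] {A : H' →L[𝕜] H} {B : H →L[𝕜] Y}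
    (hA : ∀ {ι : Set H'} {v : ι → H'}, Orthonormal 𝕜 v → ∀ s : Finset ι,
      ∑ i ∈ s, ‖A (v i)‖ ^ 2 ≤ 1)
    (hB : ∀ {ι : Set H} {v : ι → H}, Orthonormal 𝕜 v → ∀ s : Finset ι,
      ∑ i ∈ s, ‖B (v i)‖ ^ 2 ≤ 1) :
    ∃ (I : Set H) (g : I → H') (w : I → Y), Summable (fun i => ‖g i‖ * ‖w i‖) ∧
      ∀ x, HasSum (fun i => ⟪g i, x⟫_𝕜 • w i) (B (A x)) := by
  obtain ⟨I, e, -⟩ := exists_hilbertBasis 𝕜 H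
  obtain ⟨J, b, -⟩ := exists_hilbertBasis 𝕜 H'
  -- The adjoint inherits the Hilbert–Schmidt bound: expand `‖A.adjoint (e i)‖ ^ 2` in the basis
  -- `b`, exchange the sums and apply Bessel. It is needed because `B (A x) = ∑ ⟪A.adjoint (e i), x⟫
  -- • B (e i)`.
  have hadj : ∀ s : Finset I, ∑ i ∈ s, ‖A.adjoint (e i)‖ ^ 2 ≤ 1 := fun s => by
    have h1 : ∀ i, HasSum (fun j => ‖⟪e i, A (b j)⟫_𝕜‖ ^ 2) (‖A.adjoint (e i)‖ ^ 2) := fun i => by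
      have h2 := RCLike.hasSum_re 𝕜 (b.hasSum_inner_mul_inner (A.adjoint (e i)) (A.adjoint (e i)))
      rw [inner_self_eq_norm_sq] at h2
      refine h2.congr_fun fun j => ?_
      rw [← inner_conj_symm (b j), RCLike.mul_conj, ContinuousLinearMap.adjoint_inner_left]
      norm_cast
    refine hasSum_le_of_sum_le (hasSum_sum fun i _ => h1 i) fun F => ?_
    refine le_trans (Finset.sum_le_sum fun j _ => ?_) (hA b.orthonormal F)
    exact e.orthonormal.sum_inner_products_le _
  have hg2 : Summable fun i => ‖A.adjoint (e i)‖ ^ 2 :=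
    summable_of_sum_le (fun _ => by positivity) hadj
  have hw2 : Summable fun i => ‖B (e i)‖ ^ 2 :=
    summable_of_sum_le (fun _ => by positivity) (hB e.orthonormal)
  refine ⟨I, fun i => A.adjoint (e i), fun i => B (e i),
    (hg2.add hw2).of_nonneg_of_le (fun i => by positivity) fun i => ?_, fun x => ?_⟩
  · nlinarith [sq_nonneg (‖A.adjoint (e i)‖ - ‖B (e i)‖), sq_nonneg (‖A.adjoint (e i)‖ + ‖B (e i)‖)]
  · have h1 := B.hasSum (e.hasSum_repr (A x))
    refine h1.congr_fun fun i => ?_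
    rw [e.repr_apply_apply, map_smul, ContinuousLinearMap.adjoint_inner_left]

end HilbertSchmidt

/-! ### From series in the completion to nuclear maps -/

section NuclearRepresentation

variable {𝕜 X Y : Type*} [RCLike 𝕜] [AddCommGroup X] [Module 𝕜 X]
  [NormedAddCommGroup Y] [NormedSpace 𝕜 Y]

/-- Nuclearity of the identity requires vectors of `X`, whereas the Hilbert space argument produces
vectors of the completion; each of these is expanded into a geometrically controlled series from
`X`. The factor `2` accounts for the term `n = 0`, which only approximates `w` to within `‖w‖`. -/
theorem exists_hasSum_of_denseRange [CompleteSpace Y] {S : X →ₗ[𝕜] Y} (hS : DenseRange S) (w : Y) :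
    ∃ z : ℕ → X, (∀ n, ‖S (z n)‖ ≤ 2 * ‖w‖ * (1 / 2) ^ n) ∧ HasSum (fun n => S (z n)) w := by
  by_cases hw : w = 0
  · exact ⟨0, fun n => by simp [hw], by simp [hw]⟩
  have hpos : 0 < ‖w‖ := norm_pos_iff.2 hw
  obtain ⟨v, hlim, hv, h0, hn⟩ := controlled_sum_of_mem_closure
    (s := (LinearMap.range S).toAddSubgroup) (hS w) (b := fun n => ‖w‖ * (1 / 2) ^ n)
    fun n => by positivity
  choose z hz using hv
  obtain rfl : (fun n => S (z n)) = v := funext hz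
  have hbound : ∀ n, ‖S (z n)‖ ≤ 2 * ‖w‖ * (1 / 2) ^ n := fun n => by
    rcases Nat.eq_zero_or_pos n with rfl | hpn
    · have h1 := norm_sub_norm_le (S (z 0)) w
      have h2 : ‖S (z 0) - w‖ < ‖w‖ * (1 / 2) ^ 0 := by
        rw [norm_sub_rev, sub_eq_neg_add]
        exact h0
      rw [pow_zero] at *
      linarith
    · have h1 : ‖S (z n)‖ < ‖w‖ * (1 / 2) ^ n := hn n hpn
      have h2 : 0 < ‖w‖ * (1 / 2) ^ n := by positivity
      linarith
  have hsum : Summable fun n => S (z n) :=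
    Summable.of_norm_bounded (summable_geometric_two.mul_left _) hbound
  refine ⟨z, hbound, ?_⟩
  have h1 := (tendsto_add_atTop_iff_nat 1).2 hsum.hasSum.tendsto_sum_nat
  rw [← tendsto_nhds_unique h1 hlim]
  exact hsum.hasSum

/-- A representation by an absolutely convergent series over an arbitrary index type shows that
a map is nuclear. -/
theorem isNuclearMap_id_of_hasSum {q p : Seminorm 𝕜 X} {S : X →ₗ[𝕜] Y} (hS : ∀ x, ‖S x‖ = p x)
    {J : Type*} {f : J → X →ₗ[𝕜] 𝕜} {α : J → ℝ} (hf : ∀ j x, ‖f j x‖ ≤ α j * q x)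
    (hα : ∀ j, 0 ≤ α j) {z : J → X} (hsum : Summable fun j => α j * p (z j))
    (hrep : ∀ x, HasSum (fun j => f j x • S (z j)) (S x)) :
    IsNuclearMap q p LinearMap.id := by
  set c : J → ℝ := fun j => α j * p (z j) with hc
  have : Countable (Function.support c) := hsum.countable_support
  obtain ⟨e, he⟩ := exists_injective_nat (Function.support c)
  -- Each term is normalised: the weight `α j * p (z j)` moves into the scalar, leaving functionals
  -- bounded by `q` and vectors with `p`-value `1`. Only the countable support of the weights is
  -- enumerated.
  set a : ℕ → 𝕜 := Function.extend e (fun j => ((c j : ℝ) : 𝕜)) 0 with ha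
  set F : ℕ → X →ₗ[𝕜] 𝕜 :=
    Function.extend e (fun j => (((α j)⁻¹ : ℝ) : 𝕜) • f j) 0 with hF
  set y : ℕ → X := Function.extend e (fun j => (((p (z j))⁻¹ : ℝ) : 𝕜) • z j) 0 with hy
  have hα' : ∀ j : Function.support c, 0 < α j := fun j =>
    (hα j).lt_of_ne' fun h => j.2 (by simp [hc, h])
  have hp' : ∀ j : Function.support c, 0 < p (z j) := fun j =>
    (apply_nonneg p _).lt_of_ne' fun h => j.2 (by simp [hc, h])
  refine ⟨a, F, y, ?_, ⟨1, fun n x => ?_⟩, ⟨1, fun n => ?_⟩, fun x => ?_⟩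
  · refine Summable.norm ((summable_extend_zero he).2 ?_)
    refine Summable.of_norm ((hsum.norm.subtype (Function.support c)).congr fun j => ?_)
    simp [hc]
  · by_cases hn : ∃ j, e j = n
    · obtain ⟨j, rfl⟩ := hn
      rw [hF, he.extend_apply, LinearMap.smul_apply, norm_smul, RCLike.norm_ofReal,
        abs_of_pos (inv_pos.2 (hα' j)), inv_mul_le_iff₀ (hα' j), one_mul]
      exact hf j x
    · rw [hF, Function.extend_apply' _ _ _ hn]
      simp
  · by_cases hn : ∃ j, e j = n
    · obtain ⟨j, rfl⟩ := hn
      rw [hy, he.extend_apply, map_smul_eq_mul, RCLike.norm_ofReal,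
        abs_of_pos (inv_pos.2 (hp' j)), inv_mul_cancel₀ (hp' j).ne']
    · rw [hy, Function.extend_apply' _ _ _ hn]
      simp
  · have h1 : HasSum (fun n => a n • F n x • S (y n)) (S x) := by
      have h2 : HasSum (fun j : Function.support c => f j x • S (z j)) (S x) := by
        -- Terms of zero weight vanish: `α j = 0` forces `f j = 0`, and `p (z j) = 0` forces `S (z
        -- j) = 0`.
        refine (hasSum_subtype_iff_of_support_subset (f := fun j => f j x • S (z j)) ?_).2 (hrep x)
        intro j hj hcj
        apply hj
        rcases mul_eq_zero.1 hcj with h | h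
        · have h3 := hf j x
          rw [h, zero_mul] at h3
          simp [norm_le_zero_iff.1 h3]
        · have : S (z j) = 0 := by rw [← norm_eq_zero, hS, h]
          simp [this]
      have h4 := (hasSum_extend_zero he).2 h2
      refine h4.congr_fun fun n => ?_
      by_cases hn : ∃ j, e j = n
      · obtain ⟨j, rfl⟩ := hn
        rw [he.extend_apply, ha, hF, hy, he.extend_apply, he.extend_apply, he.extend_apply]
        have h5 : (α j : 𝕜) ≠ 0 := by exact_mod_cast (hα' j).ne'
        have h6 : (p (z j) : 𝕜) ≠ 0 := by exact_mod_cast (hp' j).ne'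
        rw [map_smul, LinearMap.smul_apply, smul_smul, smul_smul, smul_eq_mul]
        congr 1
        simp only [hc]
        push_cast
        field_simp
      · rw [Function.extend_apply' _ _ _ hn, ha, Function.extend_apply' _ _ _ hn]
        simp
    have h7 := (tendsto_iff_norm_sub_tendsto_zero.1 h1.tendsto_sum_nat)
    refine h7.congr fun N => ?_
    rw [norm_sub_rev, ← hS]
    simp [map_sub, map_sum, map_smul]

end NuclearRepresentation

/-! ### Nuclearity from absolutely summing inclusions -/

section Nuclearity

open scoped InnerProductSpace

variable {𝕜 X : Type*} [RCLike 𝕜] [AddCommGroup X] [Module 𝕜 X]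

/-- Two absolutely summing inclusions through Hilbertian seminorms compose to a nuclear map. -/
theorem IsAbsolutelySumming.isNuclearMap {p q r : Seminorm 𝕜 X} (hqp : IsAbsolutelySumming q p)
    (hrq : IsAbsolutelySumming r q)
    (hq : ∀ x y, q (x + y) * q (x + y) + q (x - y) * q (x - y) = 2 * (q x * q x + q y * q y))
    (hr : ∀ x y, r (x + y) * r (x + y) + r (x - y) * r (x - y) = 2 * (r x * r x + r y * r y)) :
    IsNuclearMap r p LinearMap.id := by
  obtain ⟨Y, _, _, _, S, hSd, hS⟩ := p.exists_completion
  obtain ⟨H, _, _, _, T, hTd, hT⟩ := q.exists_hilbert_completion hq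
  obtain ⟨H', _, _, _, T', hTd', hT'⟩ := r.exists_hilbert_completion hr
  set A : H' →L[𝕜] H := T.extendOfNorm T'
  have hA : ∀ x, A (T' x) = T x := LinearMap.extendOfNorm_eq hTd' ⟨1, fun x => by
    rw [hT, hT', one_mul]
    exact hrq.le x⟩
  set B : H →L[𝕜] Y := S.extendOfNorm T
  have hB : ∀ x, B (T x) = S x := LinearMap.extendOfNorm_eq hTd ⟨1, fun x => by
    rw [hS, hT, one_mul]
    exact hqp.le x⟩
  have hAs := hrq.extend hTd' hT' (B := A) fun x => by rw [hA, hT]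
  have hBs := hqp.extend hTd hT (B := B) fun x => by rw [hB, hS]
  obtain ⟨I, g, w, hgw, hrep⟩ := exists_nuclear_representation_comp (A := A) (B := B)
    (sum_sq_norm_le_of_isAbsolutelySumming hAs) (sum_sq_norm_le_of_isAbsolutelySumming hBs)
  choose z hz hzw using fun i => exists_hasSum_of_denseRange hSd (w i)
  have hα : Summable fun j : I × ℕ => ‖g j.1‖ * p (z j.1 j.2) := by
    refine Summable.of_nonneg_of_le (fun j => mul_nonneg (norm_nonneg _) (apply_nonneg p _))
      (fun j => ?_) ((hgw.mul_left 2).mul_of_nonneg summable_geometric_two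
        (fun i => by positivity) fun n => by positivity)
    rw [← hS]
    have := mul_le_mul_of_nonneg_left (hz j.1 j.2) (norm_nonneg (g j.1))
    linarith
  refine isNuclearMap_id_of_hasSum (S := S) hS (J := I × ℕ)
    (f := fun j => (innerSL 𝕜 (g j.1)).toLinearMap ∘ₗ T') (α := fun j => ‖g j.1‖)
    (z := fun j => z j.1 j.2) (fun j x => ?_) (fun j => norm_nonneg _) hα fun x => ?_
  · rw [← hT']
    exact norm_inner_le_norm _ _
  · have hsum : Summable fun j : I × ℕ => ⟪g j.1, T' x⟫_𝕜 • S (z j.1 j.2) := by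
      refine Summable.of_norm_bounded (hα.mul_right ‖T' x‖) fun j => ?_
      rw [norm_smul, hS, mul_right_comm]
      exact mul_le_mul_of_nonneg_right (norm_inner_le_norm _ _) (apply_nonneg p _)
    -- Summing over `ℕ` first recovers `w i`, so the double series has the same sum as the
    -- representation of `B (A (T' x))`.
    have h1 := hsum.hasSum.prod_fiberwise fun i => (hzw i).const_smul ⟪g i, T' x⟫_𝕜
    have h2 := hrep (T' x)
    rw [hA, hB] at h2
    rw [← h1.unique h2]
    exact hsum.hasSum

/-- If unconditional convergence implies absolute convergence, then every continuous seminorm is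
absolutely summing with respect to a Hilbertian one. -/
theorem exists_hilbertian_isAbsolutelySumming [UniformSpace X] [IsUniformAddGroup X]
    [CompleteSpace X] [FirstCountableTopology X] [PolynormableSpace 𝕜 X]
    (h : ∀ x : ℕ → X, UnconditionallyConvergent x → AbsolutelyConvergent 𝕜 x)
    {p : Seminorm 𝕜 X} (hp : Continuous p) :
    ∃ q : Seminorm 𝕜 X, Continuous q ∧ IsAbsolutelySumming q p ∧
      ∀ x y, q (x + y) * q (x + y) + q (x - y) * q (x - y) = 2 * (q x * q x + q y * q y) := by
  -- Two steps are used: the Hilbertian seminorm lies between `q₀` and `q₁`, so `q₀ ≤ r` keeps `p`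
  -- absolutely summing with respect to it and `r ≤ q₁` makes it continuous.
  obtain ⟨q₀, hq₀, hs₀⟩ := exists_isAbsolutelySumming h hp
  obtain ⟨q₁, hq₁, hs₁⟩ := exists_isAbsolutelySumming h hq₀
  obtain ⟨r, hr₀, hr₁, hpar, -⟩ := hs₁.exists_hilbertian
  exact ⟨r, Seminorm.continuous_of_le hq₁ hr₁, hs₀.mono_left hr₀, hpar⟩

end Nuclearity

theorem mainTheorem6 {𝕜 X : Type*} [RCLike 𝕜] [AddCommGroup X] [Module 𝕜 X]
    [UniformSpace X] [IsUniformAddGroup X] [ContinuousSMul 𝕜 X]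
    [PolynormableSpace 𝕜 X] [TopologicalSpace.MetrizableSpace X] [CompleteSpace X] :
    IsNuclearSpace 𝕜 X ↔
      ∀ x : ℕ → X, UnconditionallyConvergent x → AbsolutelyConvergent 𝕜 x := by
  refine ⟨fun h x hx => h.absolutelyConvergent hx, fun h p hp => ?_⟩
  have : FirstCountableTopology X :=
    let := TopologicalSpace.metrizableSpaceMetric X
    inferInstance
  -- Two Hilbertian stages are needed, since one absolutely summing inclusion gives only a
  -- Hilbert–Schmidt bound and nuclearity comes from composing two.
  obtain ⟨q, hq, hqp, hqpar⟩ := exists_hilbertian_isAbsolutelySumming h hp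
  obtain ⟨r, hr, hrq, hrpar⟩ := exists_hilbertian_isAbsolutelySumming h hq
  exact ⟨r, hr, hqp.le.trans hrq.le, hqp.isNuclearMap hrq hqpar hrpar⟩
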